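/- A $\sigma$-finite measure space $(S,\mathcal S,\mu)$ has the approximation-by-averaging property if for every $n\in\mathbb N$ there is a finite or countable family $\mathfrak B_n$ of pairwise disjoint measurable subsets of $S$ of positive, finite measure such that, for every real Banach space $E$, every $p\in[1,\infty)$ and every $f\in L^p(S;E)$, the averages $f_n:=\sum_{B\in\mathfrak B_n}\mathbf 1_B\,\frac1{\mu(B)}\int_B f\,d\mu$ converge to $f$ in $L^p(S;E)$ as $n\to\infty$. For $q\in[1,\infty)$, the Khintchine constant $B_q\in(0,\infty)$ is the smallest positive constant such that $\bigl\|\sum_{j=1}^n r_ja_j\bigr\|_{L^q}\le B_q\bigl(\sum_{j=1}^n a_j^2\bigr)^{1/2}$ for every family $(r_j)_{j\in\mathbb N}$ of independent random variables with values in $\{-1,1\}$, each taken with probability $\frac12$, and all $n\in\mathbb{N}$, $a_1,\dots,a_n\in\mathbb R$. Let $(S,\mathcal S,\mu)$ be a $\sigma$-finite measure space with the approximation-by-averaging property, let $(\Omega,\mathcal A,\mathbb P)$ be a probability space, let $1\le p\le q<\infty$, $\bar q:=\min\{q,2\}$, and $M\in\mathbb N$, $M\ge1$. Let $\eta_1,\dots,\eta_M$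 be independent and identically distributed $L^p(S)$-valued random variables in $L^q(\Omega;L^p(S))\cap L^p(S;L^q(\Omega))$ with $\mathbb E[\eta_1]=0$. Here $\eta_j\in L^p(S;L^q(\Omega))$ means that for a measurable function $\widetilde\eta_j\colon S\times\Omega\to\mathbb R$ with $\eta_j(\omega)=\widetilde\eta_j(\cdot,\omega)$ in $L^p(S)$ for almost all $\omega$, the map $s\mapsto\widetilde\eta_j(s,\cdot)$ belongs to $L^p(S;L^q(\Omega))$, and $\|\eta_j\|_{L^p(S;L^q(\Omega))}$ is the norm of that map. Then $$\Bigl\|\frac1M\sum_{j=1}^M\eta_j\Bigr\|_{L^q(\Omega;L^p(S))}\le 2\,B_q\,M^{-(1-1/\bar q)}\,\|\eta_1\|_{L^p(S;L^q(\Omega))}.$$ -/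

import Mathlib

open MeasureTheory ProbabilityTheory Filter Topology
open scoped ENNReal

universe u v w

noncomputable section

/-- The average of `f` with respect to a family `𝓑` of sets: on each `A ∈ 𝓑` it is the constant
`μ(A)⁻¹ ∫_A f dμ`, and it vanishes outside `⋃ 𝓑`. For a pairwise disjoint family, at most one
term of the sum is nonzero at each point. -/
def averageOver {S : Type u} [MeasurableSpace S] (μ : Measure S) {E : Type w}
    [NormedAddCommGroup E] [NormedSpace ℝ E] (𝓑 : Set (Set S)) (f : S → E) : S → E :=
  fun s => ∑' A : 𝓑, (A : Set S).indicator (fun _ => (μ.real A)⁻¹ • ∫ x in (A : Set S), f x ∂μ) s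

/-- The approximation-by-averaging property of a measure space: there are countable families
`𝓑 n` of pairwise disjoint measurable sets of positive finite measure such that for every real
Banach space `E`, every `p ∈ [1, ∞)` and every `f ∈ L^p(S; E)` the averages of `f` over `𝓑 n`
converge to `f` in `L^p(S; E)`. -/
def ApproximationByAveraging {S : Type u} [MeasurableSpace S] (μ : Measure S) : Prop :=
  ∃ 𝓑 : ℕ → Set (Set S),
    (∀ n, (𝓑 n).Countable ∧ (𝓑 n).PairwiseDisjoint id ∧
      ∀ A ∈ 𝓑 n, MeasurableSet A ∧ 0 < μ A ∧ μ A < ∞) ∧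
    ∀ (E : Type w) [NormedAddCommGroup E] [NormedSpace ℝ E] [CompleteSpace E]
      (p : ℝ≥0∞), 1 ≤ p → p ≠ ∞ → ∀ f : S → E, MemLp f p μ →
        Tendsto (fun n => eLpNorm (f - averageOver μ (𝓑 n) f) p μ) atTop (𝓝 0)

/-- A Rademacher family: independent random variables with values in `{-1, 1}`, each value being
taken with probability `1/2`. -/
structure IsRademacherFamily {Ω : Type v} [MeasurableSpace Ω] (P : Measure Ω)
    (r : ℕ → Ω → ℝ) : Prop where
  measurable : ∀ j, Measurable (r j)
  mem : ∀ j ω, r j ω = -1 ∨ r j ω = 1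
  indep : iIndepFun r P
  prob_neg_one : ∀ j, P {ω | r j ω = -1} = 1 / 2
  prob_one : ∀ j, P {ω | r j ω = 1} = 1 / 2

/-- The (upper) Khintchine constant `B_q`: the smallest `B > 0` such that
`‖∑ r_j a_j‖_{L^q} ≤ B (∑ a_j²)^{1/2}` for every Rademacher family `(r_j)` on a probability space
and every finite real sequence `(a_j)`. (The law of a Rademacher family is unique, so neither the
universe of the probability space nor its completeness affects the value.) -/
def khintchineConst (q : ℝ≥0∞) : ℝ :=
  sInf {B : ℝ | 0 < B ∧ ∀ (Ω : Type) [MeasurableSpace Ω] (P : Measure Ω) [IsProbabilityMeasure P]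
    (r : ℕ → Ω → ℝ), IsRademacherFamily P r → ∀ (n : ℕ) (a : ℕ → ℝ),
      eLpNorm (fun ω => ∑ j ∈ Finset.range n, r j ω * a j) q P ≤
        ENNReal.ofReal (B * √(∑ j ∈ Finset.range n, a j ^ 2))}

/-- `η : Ω → L^p(S)` and `F : S → L^q(Ω)` come from one function: there is a (jointly) measurable
`f : S × Ω → ℝ` with `η(ω) = f(·, ω)` in `L^p(S)` for almost all `ω` and `F(s) = f(s, ·)` in
`L^q(Ω)` for almost all `s`. Thus an element of `L^q(Ω; L^p(S)) ∩ L^p(S; L^q(Ω))` is such a pair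
with `η ∈ L^q(Ω; L^p(S))` and `F ∈ L^p(S; L^q(Ω))`; `F` is determined by `η` almost everywhere. -/
def HaveCommonRepresentative {S : Type u} [MeasurableSpace S] {μ : Measure S}
    {Ω : Type v} [MeasurableSpace Ω] {P : Measure Ω} {p q : ℝ≥0∞}
    (η : Ω → Lp ℝ p μ) (F : S → Lp ℝ q P) : Prop :=
  ∃ f : S × Ω → ℝ, Measurable f ∧
    (∀ᵐ ω ∂P, (η ω : S → ℝ) =ᵐ[μ] fun s => f (s, ω)) ∧
    (∀ᵐ s ∂μ, (F s : Ω → ℝ) =ᵐ[P] fun ω => f (s, ω))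

end

/-! For almost every point `s` the values at `s` of the `η j` are independent, identically
distributed, centred scalar variables in `L^q(Ω)`, so the bound reduces to a scalar one followed by
an exchange of norms.

Scalar bound: symmetrization by signs costs the factor 2. Averaging over random signs and applying
Khintchine's inequality for each fixed `ω` leaves the square function with constant `B_q`. Comparing
the square function with the sum of `q`-th powers gives `M ^ (1 / min q 2)`; dividing by `M`
produces the stated rate. Taking the `L^p(S)` norm and applying Minkowski's inequality, where `p ≤
q` enters, finishes the proof.

The delicate point is the pointwise reduction, because elements of `L^p` have no values at points.
Strong measurability puts almost all values of the `η j` in one separable set, on which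
`exists_measurable_evaluation` supplies a jointly measurable `e`. Then `e (s, η j ω)` is the same
measurable function of each `η j`, hence inherits independence and equality in law, and Fubini
identifies it with the given representative. -/

/-! ### Symmetrization -/

/-- Adding an independent centred random variable does not decrease the `L^q` norm. -/
lemma eLpNorm_le_eLpNorm_add_of_indepFun {Ω : Type*} [MeasurableSpace Ω] {P : Measure Ω}
    [IsProbabilityMeasure P] {q : ℝ≥0∞} (hq : 1 ≤ q) {X Y : Ω → ℝ} (hX : Measurable X)
    (hY : Measurable Y) (hXi : Integrable X P) (hYi : Integrable Y P) (hXY : IndepFun X Y P)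
    (hmean : ∫ ω, Y ω ∂P = 0) : eLpNorm X q P ≤ eLpNorm (X + Y) q P := by
  -- Conditioning on `X` turns `X + Y` into `X`, and conditional expectation contracts `L^q`.
  have hle : MeasurableSpace.comap X inferInstance ≤ (inferInstance : MeasurableSpace Ω) :=
    hX.comap_le
  have hcY : P[Y|MeasurableSpace.comap X inferInstance] =ᵐ[P] fun _ => ∫ ω, Y ω ∂P :=
    condExp_indep_eq hY.comap_le hle (comap_measurable Y).stronglyMeasurable hXY.symm
  have hcX : P[X|MeasurableSpace.comap X inferInstance] = X :=
    condExp_of_stronglyMeasurable hle (comap_measurable X).stronglyMeasurable hXi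
  have hc : P[X + Y|MeasurableSpace.comap X inferInstance] =ᵐ[P] X := by
    filter_upwards [condExp_add hXi hYi (MeasurableSpace.comap X inferInstance), hcY] with ω h1 h2
    rw [h1, Pi.add_apply, h2, hcX, hmean, add_zero]
  rw [← eLpNorm_congr_ae hc]
  exact eLpNorm_condExp_le_eLpNorm _ hq

/-- Symmetrization of a sum of independent centred random variables by deterministic signs. -/
lemma eLpNorm_sum_le_two_mul_eLpNorm_sign_sum {Ω ι : Type*} [Fintype ι] [MeasurableSpace Ω]
    {P : Measure Ω} [IsProbabilityMeasure P] {q : ℝ≥0∞} (hq : 1 ≤ q) {X : ι → Ω → ℝ}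
    (hX : ∀ j, Measurable (X j)) (hXi : ∀ j, Integrable (X j) P) (hind : iIndepFun X P)
    (hmean : ∀ j, ∫ ω, X j ω ∂P = 0) (ε : ι → ℝ) (hε : ∀ j, ε j = -1 ∨ ε j = 1) :
    eLpNorm (fun ω => ∑ j, X j ω) q P ≤ 2 * eLpNorm (fun ω => ∑ j, ε j * X j ω) q P := by
  classical
  -- Grouping by sign, the signed sum is `U - V` and the plain sum is `U + V`. As `U` and `V` are
  -- independent and centred, each has norm at most that of `U - V`; the triangle inequality gives
  -- the factor 2.
  set A : Finset ι := Finset.univ.filter fun j => ε j = 1 with hA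
  set U : Ω → ℝ := fun ω => ∑ j ∈ A, X j ω with hU
  set V : Ω → ℝ := fun ω => ∑ j ∈ Aᶜ, X j ω with hV
  have hUm : Measurable U := Finset.measurable_sum _ fun j _ => hX j
  have hVm : Measurable V := Finset.measurable_sum _ fun j _ => hX j
  have hUi : Integrable U P := integrable_finsetSum _ fun j _ => hXi j
  have hVi : Integrable V P := integrable_finsetSum _ fun j _ => hXi j
  have hU0 : ∫ ω, U ω ∂P = 0 := by
    rw [hU, integral_finsetSum _ fun j _ => hXi j]; simp [hmean]
  have hV0 : ∫ ω, V ω ∂P = 0 := by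
    rw [hV, integral_finsetSum _ fun j _ => hXi j]; simp [hmean]
  have hUV : IndepFun U V P := by
    have h := (hind.indepFun_finset A Aᶜ disjoint_compl_right hX).comp
      (φ := fun x : A → ℝ => ∑ j, x j) (ψ := fun x : (Aᶜ : Finset ι) → ℝ => ∑ j, x j)
      (by fun_prop) (by fun_prop)
    convert h using 1
    · ext ω; exact (Finset.sum_coe_sort A fun j => X j ω).symm
    · ext ω; exact (Finset.sum_coe_sort Aᶜ fun j => X j ω).symm
  have hsum : (fun ω => ∑ j, X j ω) = U + V := by
    ext ω; exact (Finset.sum_add_sum_compl A fun j => X j ω).symm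
  have hdiff : (fun ω => ∑ j, ε j * X j ω) = U + -V := by
    ext ω
    rw [← Finset.sum_add_sum_compl A]
    simp only [Pi.add_apply, Pi.neg_apply, hU, hV, ← Finset.sum_neg_distrib]
    congr 1
    · refine Finset.sum_congr rfl fun j hj => ?_
      rw [(Finset.mem_filter.1 hj).2, one_mul]
    · refine Finset.sum_congr rfl fun j hj => ?_
      have h1 : ¬ ε j = 1 := by simpa [hA] using hj
      rw [(hε j).resolve_right h1, neg_one_mul]
  have h1 : eLpNorm U q P ≤ eLpNorm (U + -V) q P :=
    eLpNorm_le_eLpNorm_add_of_indepFun hq hUm hVm.neg hUi hVi.neg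
      (hUV.comp measurable_id measurable_neg) (by simp [integral_neg, hV0])
  have h2 : eLpNorm V q P ≤ eLpNorm (U + -V) q P := by
    rw [← eLpNorm_neg V, add_comm]
    exact eLpNorm_le_eLpNorm_add_of_indepFun hq hVm.neg hUm hVi.neg hUi
      (hUV.symm.comp measurable_neg measurable_id) hU0
  rw [hsum, hdiff, two_mul]
  exact (eLpNorm_add_le hUm.aestronglyMeasurable hVm.aestronglyMeasurable hq).trans
    (add_le_add h1 h2)

/-! ### Rademacher families and Khintchine's inequality -/

/-- The uniform measure on the two-point space. -/
noncomputable def fairCoin : Measure Bool := (PMF.uniformOfFintype Bool).toMeasure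

instance : IsProbabilityMeasure fairCoin := by unfold fairCoin; infer_instance

lemma fairCoin_singleton (b : Bool) : fairCoin {b} = 1 / 2 := by
  rw [fairCoin, PMF.toMeasure_apply_singleton _ _ (measurableSet_singleton b)]
  simp

/-- The coordinates of a sequence of fair coin flips form a Rademacher family. -/
lemma isRademacherFamily_coinFlips :
    IsRademacherFamily (Measure.infinitePi fun _ : ℕ => fairCoin)
      (fun j ω => if ω j then (1 : ℝ) else -1) := by
  have hm : Measurable fun b : Bool => if b then (1 : ℝ) else -1 := measurable_of_countable _
  have hprob : ∀ (j : ℕ) (b : Bool),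
      Measure.infinitePi (fun _ : ℕ => fairCoin) {ω | ω j = b} = 1 / 2 := fun j b => by
    have h := congrArg (fun ν : Measure Bool => ν {b})
      (Measure.infinitePi_map_eval (fun _ : ℕ => fairCoin) j)
    rw [Measure.map_apply (measurable_pi_apply j) (measurableSet_singleton b)] at h
    exact h.trans (fairCoin_singleton b)
  refine ⟨fun j => hm.comp (measurable_pi_apply j), fun j ω => ?_,
    iIndepFun_infinitePi (P := fun _ : ℕ => fairCoin)
      (X := fun _ (b : Bool) => if b then (1 : ℝ) else -1) fun _ => hm, fun j => ?_, fun j => ?_⟩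
  · by_cases h : ω j <;> simp [h]
  · rw [← hprob j false]; congr 1; ext ω
    by_cases h : ω j <;> simp [h]; norm_num
  · rw [← hprob j true]; congr 1; ext ω
    by_cases h : ω j <;> simp [h]; norm_num

lemma IsRademacherFamily.integral_eq_zero {Ω : Type*} [MeasurableSpace Ω] {P : Measure Ω}
    [IsProbabilityMeasure P] {r : ℕ → Ω → ℝ} (hr : IsRademacherFamily P r) (j : ℕ) :
    ∫ ω, r j ω ∂P = 0 := by
  have hs1 : MeasurableSet {ω | r j ω = 1} := hr.measurable j (measurableSet_singleton 1)
  have hs2 : MeasurableSet {ω | r j ω = -1} := hr.measurable j (measurableSet_singleton (-1))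
  have h : r j = fun ω => {ω | r j ω = 1}.indicator (fun _ => (1 : ℝ)) ω
      - {ω | r j ω = -1}.indicator (fun _ => (1 : ℝ)) ω := by
    ext ω
    rcases hr.mem j ω with h | h <;> simp [Set.indicator, h] <;> norm_num
  rw [h, integral_sub ((integrable_const _).indicator hs1) ((integrable_const _).indicator hs2),
    integral_indicator_const _ hs1, integral_indicator_const _ hs2]
  simp [Measure.real, hr.prob_one, hr.prob_neg_one]

/-- A Rademacher sum is sub-Gaussian with variance proxy `∑ a_j ^ 2`. -/
lemma IsRademacherFamily.hasSubgaussianMGF_sum {Ω : Type*} [MeasurableSpace Ω] {P : Measure Ω}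
    [IsProbabilityMeasure P] {r : ℕ → Ω → ℝ} (hr : IsRademacherFamily P r) (n : ℕ) (a : ℕ → ℝ) :
    HasSubgaussianMGF (fun ω => ∑ j ∈ Finset.range n, r j ω * a j)
      (∑ j ∈ Finset.range n, ‖a j‖₊ ^ 2) P := by
  -- Hoeffding's lemma on `[-1, 1]`: the proxy is the squared half-length, 1.
  have hone : ∀ j, HasSubgaussianMGF (r j) 1 P := fun j => by
    have h := hasSubgaussianMGF_of_mem_Icc_of_integral_eq_zero (a := -1) (b := 1)
      (hr.measurable j).aemeasurable
      (ae_of_all P fun ω => by rcases hr.mem j ω with h | h <;> rw [h] <;> norm_num)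
      (hr.integral_eq_zero j)
    convert h using 1
    ext; norm_num
  refine HasSubgaussianMGF.sum_of_iIndepFun (X := fun j ω => r j ω * a j)
    (hr.indep.comp (fun j x => x * a j) fun j => by fun_prop) fun j _ => ?_
  convert (hone j).const_mul (a j) using 1
  · ext ω; ring
  · refine NNReal.coe_injective ?_
    change ‖a j‖ ^ 2 = a j ^ 2 * 1
    simp

/-- Absolute moments of a sub-Gaussian random variable of variance proxy `σ ^ 2`. -/
lemma ProbabilityTheory.HasSubgaussianMGF.eLpNorm_natCast_le {Ω : Type*} [MeasurableSpace Ω]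
    {P : Measure Ω} [IsProbabilityMeasure P] {X : Ω → ℝ} {c : NNReal}
    (hX : HasSubgaussianMGF X c P) {σ : ℝ} (hσ : 0 < σ) (hc : (c : ℝ) = σ ^ 2) {k : ℕ}
    (hk : 1 ≤ k) :
    eLpNorm X k P ≤ ENNReal.ofReal (k.factorial * (2 * Real.exp (1 / 2)) * σ) := by
  set C : ℝ := k.factorial * (2 * Real.exp (1 / 2)) with hC
  have hk0 : (k : ℝ) ≠ 0 := by positivity
  have hC1 : 1 ≤ C := by
    have h1 : (1 : ℝ) ≤ k.factorial := by exact_mod_cast k.factorial_pos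
    have h2 : (1 : ℝ) ≤ Real.exp (1 / 2) := Real.one_le_exp (by norm_num)
    nlinarith
  -- One term of the Taylor series of `exp |y|` bounds the moment by exponential moments, evaluated
  -- below at `±σ⁻¹`, where the sub-Gaussian bound is `exp (1 / 2)`.
  have hpt : ∀ y : ℝ, |y| ^ k ≤ k.factorial * (Real.exp y + Real.exp (-y)) := fun y => by
    have h := Real.pow_div_factorial_le_exp |y| (abs_nonneg y) k
    rw [div_le_iff₀' (by positivity)] at h
    refine h.trans (mul_le_mul_of_nonneg_left ?_ (by positivity))
    rcases abs_choice y with h | h <;> rw [h]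
    · linarith [Real.exp_pos (-y)]
    · linarith [Real.exp_pos y]
  have hi1 := hX.integrable_exp_mul σ⁻¹
  have hi2 := hX.integrable_exp_mul (-σ⁻¹)
  have hm : ∀ t : ℝ, t ^ 2 = (σ ^ 2)⁻¹ → ∫ ω, Real.exp (t * X ω) ∂P ≤ Real.exp (1 / 2) := by
    intro t ht
    refine (hX.mgf_le t).trans_eq ?_
    rw [hc, ht, mul_inv_cancel₀ (by positivity)]
  have hmom : ∫⁻ ω, ‖σ⁻¹ * X ω‖ₑ ^ (k : ℝ) ∂P ≤ ENNReal.ofReal C := by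
    calc ∫⁻ ω, ‖σ⁻¹ * X ω‖ₑ ^ (k : ℝ) ∂P
        ≤ ∫⁻ ω, ENNReal.ofReal (k.factorial *
            (Real.exp (σ⁻¹ * X ω) + Real.exp (-σ⁻¹ * X ω))) ∂P := by
          refine lintegral_mono fun ω => ?_
          rw [ENNReal.rpow_natCast, ← ofReal_norm, Real.norm_eq_abs,
            ← ENNReal.ofReal_pow (abs_nonneg _), neg_mul]
          exact ENNReal.ofReal_le_ofReal (hpt _)
      _ = ENNReal.ofReal (∫ ω, k.factorial *
            (Real.exp (σ⁻¹ * X ω) + Real.exp (-σ⁻¹ * X ω)) ∂P) :=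
          (ofReal_integral_eq_lintegral_ofReal ((hi1.add hi2).const_mul _)
            (ae_of_all _ fun ω => mul_nonneg (Nat.cast_nonneg _)
              (add_pos (Real.exp_pos _) (Real.exp_pos _)).le)).symm
      _ ≤ ENNReal.ofReal C := by
          refine ENNReal.ofReal_le_ofReal ?_
          rw [integral_const_mul, integral_add hi1 hi2, hC]
          refine mul_le_mul_of_nonneg_left ?_ (by positivity)
          linarith [hm σ⁻¹ (by rw [inv_pow]), hm (-σ⁻¹) (by rw [neg_sq, inv_pow])]
  have hY : eLpNorm (fun ω => σ⁻¹ * X ω) k P ≤ ENNReal.ofReal C := by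
    rw [eLpNorm_eq_lintegral_rpow_enorm_toReal (by exact_mod_cast (by lia : k ≠ 0))
      (ENNReal.natCast_ne_top k), ENNReal.toReal_natCast]
    calc (∫⁻ ω, ‖σ⁻¹ * X ω‖ₑ ^ (k : ℝ) ∂P) ^ (1 / (k : ℝ))
        ≤ ENNReal.ofReal C ^ (1 / (k : ℝ)) := by gcongr
      _ ≤ ENNReal.ofReal C ^ (1 : ℝ) := by
          refine ENNReal.rpow_le_rpow_of_exponent_le (by simpa using hC1) ?_
          rw [div_le_one (by positivity)]
          exact_mod_cast hk
      _ = ENNReal.ofReal C := ENNReal.rpow_one _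
  have hXY : X = σ • fun ω => σ⁻¹ * X ω := by
    ext ω
    simp [hσ.ne']
  rw [hXY, eLpNorm_const_smul, mul_comm, ENNReal.ofReal_mul (by positivity),
    ← ofReal_norm, Real.norm_of_nonneg hσ.le]
  gcongr

/-- **Khintchine's inequality**: there is an admissible constant for every finite exponent. -/
lemma exists_khintchine_bound {q : ℝ≥0∞} (hq : q ≠ ∞) :
    ∃ B : ℝ, 0 < B ∧ ∀ (Ω : Type) [MeasurableSpace Ω] (P : Measure Ω) [IsProbabilityMeasure P]
      (r : ℕ → Ω → ℝ), IsRademacherFamily P r → ∀ (n : ℕ) (a : ℕ → ℝ),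
        eLpNorm (fun ω => ∑ j ∈ Finset.range n, r j ω * a j) q P ≤
          ENNReal.ofReal (B * √(∑ j ∈ Finset.range n, a j ^ 2)) := by
  -- On a probability space `L^q` norms increase with `q`, so integer exponents suffice.
  obtain ⟨k, hk1, hqk⟩ : ∃ k : ℕ, 1 ≤ k ∧ q ≤ k := by
    obtain ⟨m, hm⟩ := ENNReal.exists_nat_gt hq
    exact ⟨m + 1, by lia, hm.le.trans (by exact_mod_cast Nat.le_succ m)⟩
  refine ⟨k.factorial * (2 * Real.exp (1 / 2)), by positivity, ?_⟩
  intro Ω _ P _ r hr n a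
  have hsub := hr.hasSubgaussianMGF_sum n a
  have hc : ((∑ j ∈ Finset.range n, ‖a j‖₊ ^ 2 : NNReal) : ℝ) = ∑ j ∈ Finset.range n, a j ^ 2 := by
    push_cast
    simp
  have hnonneg : 0 ≤ ∑ j ∈ Finset.range n, a j ^ 2 := Finset.sum_nonneg fun j _ => sq_nonneg _
  rcases hnonneg.eq_or_lt with h0 | hpos
  · have ha : ∀ j ∈ Finset.range n, a j = 0 := fun j hj =>
      pow_eq_zero_iff two_ne_zero |>.1
        ((Finset.sum_eq_zero_iff_of_nonneg fun j _ => sq_nonneg (a j)).1 h0.symm j hj)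
    have hz : (fun ω => ∑ j ∈ Finset.range n, r j ω * a j) = 0 := by
      ext ω
      exact Finset.sum_eq_zero fun j hj => by rw [ha j hj, mul_zero]
    rw [hz, eLpNorm_zero]
    exact zero_le
  · refine (eLpNorm_le_eLpNorm_of_exponent_le hqk hsub.aestronglyMeasurable).trans ?_
    exact hsub.eLpNorm_natCast_le (Real.sqrt_pos.2 hpos) (by rw [hc, Real.sq_sqrt hnonneg]) hk1

lemma khintchineConst_nonneg (q : ℝ≥0∞) : 0 ≤ khintchineConst q :=
  Real.sInf_nonneg fun _ hB => hB.1.le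

/-- The Khintchine constant is itself admissible in Khintchine's inequality. -/
lemma eLpNorm_rademacher_sum_le {q : ℝ≥0∞} (hq : q ≠ ∞) {Ω : Type} [MeasurableSpace Ω]
    {P : Measure Ω} [IsProbabilityMeasure P] {r : ℕ → Ω → ℝ} (hr : IsRademacherFamily P r)
    (n : ℕ) (a : ℕ → ℝ) :
    eLpNorm (fun ω => ∑ j ∈ Finset.range n, r j ω * a j) q P ≤
      ENNReal.ofReal (khintchineConst q * √(∑ j ∈ Finset.range n, a j ^ 2)) := by
  set σ := √(∑ j ∈ Finset.range n, a j ^ 2) with hσ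
  have hσ0 : 0 ≤ σ := Real.sqrt_nonneg _
  -- Admissible constants exist within any `δ > 0` of the infimum; letting `δ → 0` makes the infimum
  -- itself admissible.
  refine ge_of_tendsto (x := 𝓝[>] (0 : ℝ))
    (f := fun δ : ℝ => ENNReal.ofReal ((khintchineConst q + δ) * σ)) ?_ ?_
  · have h : Tendsto (fun δ : ℝ => ENNReal.ofReal ((khintchineConst q + δ) * σ)) (𝓝 0)
        (𝓝 (ENNReal.ofReal ((khintchineConst q + 0) * σ))) :=
      (ENNReal.continuous_ofReal.comp (by fun_prop)).tendsto _
    rw [add_zero] at h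
    exact h.mono_left nhdsWithin_le_nhds
  · filter_upwards [self_mem_nhdsWithin] with δ hδ
    obtain ⟨B, hB, hlt⟩ := Real.lt_sInf_add_pos (exists_khintchine_bound hq) hδ
    refine (hB.2 Ω P r hr n a).trans (ENNReal.ofReal_le_ofReal ?_)
    exact mul_le_mul_of_nonneg_right hlt.le hσ0

/-! ### Square functions and sums of independent variables -/

lemma eLpNorm_rpow_toReal_eq_lintegral {α E : Type*} [MeasurableSpace α] [NormedAddCommGroup E]
    {μ : Measure α} {q : ℝ≥0∞} (hq0 : q ≠ 0) (hq : q ≠ ∞) (f : α → E) :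
    eLpNorm f q μ ^ q.toReal = ∫⁻ x, ‖f x‖ₑ ^ q.toReal ∂μ := by
  rw [eLpNorm_eq_lintegral_rpow_enorm_toReal hq0 hq, ← ENNReal.rpow_mul,
    one_div_mul_cancel (ENNReal.toReal_pos hq0 hq).ne', ENNReal.rpow_one]

/-- For `Q ≤ 2` the map `t ↦ t ^ (Q / 2)` is subadditive and the power of the cardinality is 0; for
`Q ≥ 2` it is convex and the power is `Q / 2 - 1`. -/
lemma ENNReal.sum_sq_rpow_half_le {ι : Type*} (s : Finset ι) (x : ι → ℝ≥0∞) {Q : ℝ}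
    (hQ : 0 < Q) :
    (∑ j ∈ s, x j ^ 2) ^ (Q / 2) ≤ (s.card : ℝ≥0∞) ^ (Q / min Q 2 - 1) * ∑ j ∈ s, x j ^ Q := by
  have hx : ∀ j, (x j ^ 2) ^ (Q / 2) = x j ^ Q := fun j => by
    rw [← ENNReal.rpow_two, ← ENNReal.rpow_mul]
    congr 1
    ring
  rcases le_total Q 2 with h | h
  · rw [min_eq_left h, div_self hQ.ne', sub_self, ENNReal.rpow_zero, one_mul]
    refine (Finset.le_sum_of_subadditive (fun y : ℝ≥0∞ => y ^ (Q / 2)) ?_ ?_ s _).trans_eq ?_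
    · simp [ENNReal.zero_rpow_of_pos (half_pos hQ)]
    · exact fun a b => ENNReal.rpow_add_le_add_rpow a b (by linarith) (by linarith)
    · exact Finset.sum_congr rfl fun j _ => hx j
  · rw [min_eq_right h]
    refine (ENNReal.rpow_sum_le_const_mul_sum_rpow s _ (by linarith)).trans_eq ?_
    simp only [hx]

lemma ENNReal.ofReal_sqrt_sum_sq_rpow {ι : Type*} (s : Finset ι) (x : ι → ℝ) (Q : ℝ) :
    ENNReal.ofReal (√(∑ j ∈ s, x j ^ 2)) ^ Q = (∑ j ∈ s, ‖x j‖ₑ ^ 2) ^ (Q / 2) := by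
  have h0 : 0 ≤ ∑ j ∈ s, x j ^ 2 := Finset.sum_nonneg fun j _ => sq_nonneg _
  rw [Real.sqrt_eq_rpow, ← ENNReal.ofReal_rpow_of_nonneg h0 (by norm_num), ← ENNReal.rpow_mul,
    ENNReal.ofReal_sum_of_nonneg fun j _ => sq_nonneg _]
  congr 1
  · refine Finset.sum_congr rfl fun j _ => ?_
    rw [← ofReal_norm, ← ENNReal.ofReal_pow (norm_nonneg _), Real.norm_eq_abs, sq_abs]
  · ring

/-- Square function estimate for sums of independent centred random variables. -/
lemma lintegral_sum_rpow_le_square_function {Ω : Type*} [MeasurableSpace Ω]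
    {P : Measure Ω} [IsProbabilityMeasure P] {q : ℝ≥0∞} (hq1 : 1 ≤ q) (hq : q ≠ ∞) {M : ℕ}
    {X : Fin M → Ω → ℝ} (hX : ∀ j, Measurable (X j)) (hXi : ∀ j, Integrable (X j) P)
    (hind : iIndepFun X P) (hmean : ∀ j, ∫ ω, X j ω ∂P = 0) :
    ∫⁻ ω, ‖∑ j, X j ω‖ₑ ^ q.toReal ∂P ≤ ENNReal.ofReal (2 * khintchineConst q) ^ q.toReal *
      ∫⁻ ω, (∑ j, ‖X j ω‖ₑ ^ 2) ^ (q.toReal / 2) ∂P := by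
  have hq0 : q ≠ 0 := (zero_lt_one.trans_le hq1).ne'
  have hQ : 0 ≤ q.toReal := ENNReal.toReal_nonneg
  set ν := Measure.infinitePi fun _ : ℕ => fairCoin with hν
  set r : ℕ → (ℕ → Bool) → ℝ := fun j ω => if ω j then 1 else -1 with hr
  have hR : IsRademacherFamily ν r := isRademacherFamily_coinFlips
  -- The bound holds for every fixed choice of signs, so it may be averaged over the coin flips.
  have hsign : ∀ ω', ∫⁻ ω, ‖∑ j, X j ω‖ₑ ^ q.toReal ∂P ≤
      2 ^ q.toReal * ∫⁻ ω, ‖∑ j : Fin M, r j ω' * X j ω‖ₑ ^ q.toReal ∂P := fun ω' => by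
    have h := ENNReal.rpow_le_rpow (eLpNorm_sum_le_two_mul_eLpNorm_sign_sum hq1 hX hXi hind hmean
      (fun j => r j ω') fun j => hR.mem j ω') hQ
    rwa [ENNReal.mul_rpow_of_nonneg _ _ hQ, eLpNorm_rpow_toReal_eq_lintegral hq0 hq,
      eLpNorm_rpow_toReal_eq_lintegral hq0 hq] at h
  have hjoint : Measurable fun z : (ℕ → Bool) × Ω =>
      ‖∑ j : Fin M, r j z.1 * X j z.2‖ₑ ^ q.toReal := by
    refine Measurable.pow_const (Measurable.enorm (Finset.measurable_sum _ fun j _ => ?_)) _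
    exact ((hR.measurable j).comp measurable_fst).mul ((hX j).comp measurable_snd)
  have hkh : ∀ ω, ∫⁻ ω', ‖∑ j : Fin M, r j ω' * X j ω‖ₑ ^ q.toReal ∂ν ≤
      ENNReal.ofReal (khintchineConst q) ^ q.toReal *
        (∑ j, ‖X j ω‖ₑ ^ 2) ^ (q.toReal / 2) := fun ω => by
    have h := ENNReal.rpow_le_rpow (eLpNorm_rademacher_sum_le hq hR M
      fun n => if h : n < M then X ⟨n, h⟩ ω else 0) hQ
    rw [eLpNorm_rpow_toReal_eq_lintegral hq0 hq, ENNReal.ofReal_mul (khintchineConst_nonneg q),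
      ENNReal.mul_rpow_of_nonneg _ _ hQ, Finset.sum_range, ENNReal.ofReal_sqrt_sum_sq_rpow] at h
    simpa [Finset.sum_range] using h
  calc ∫⁻ ω, ‖∑ j, X j ω‖ₑ ^ q.toReal ∂P
      = ∫⁻ _ω', ∫⁻ ω, ‖∑ j, X j ω‖ₑ ^ q.toReal ∂P ∂ν := by simp
    _ ≤ ∫⁻ ω', 2 ^ q.toReal * ∫⁻ ω, ‖∑ j : Fin M, r j ω' * X j ω‖ₑ ^ q.toReal ∂P ∂ν :=
        lintegral_mono hsign
    _ = 2 ^ q.toReal * ∫⁻ ω, ∫⁻ ω', ‖∑ j : Fin M, r j ω' * X j ω‖ₑ ^ q.toReal ∂ν ∂P := by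
        rw [lintegral_const_mul _ hjoint.lintegral_prod_right',
          lintegral_lintegral_swap hjoint.aemeasurable]
    _ ≤ 2 ^ q.toReal * ∫⁻ ω, ENNReal.ofReal (khintchineConst q) ^ q.toReal *
          (∑ j, ‖X j ω‖ₑ ^ 2) ^ (q.toReal / 2) ∂P := by gcongr with ω; exact hkh ω
    _ = _ := by
        rw [lintegral_const_mul _ (by fun_prop), ← mul_assoc, ← ENNReal.mul_rpow_of_nonneg _ _ hQ,
          ENNReal.ofReal_mul zero_le_two, ENNReal.ofReal_ofNat]

/-- The `L^q` norm of a sum of `M` independent centred random variables of equal `L^q` norm. -/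
lemma eLpNorm_sum_le_of_iIndepFun {Ω : Type*} [MeasurableSpace Ω]
    {P : Measure Ω} [IsProbabilityMeasure P] {q : ℝ≥0∞} (hq1 : 1 ≤ q) (hq : q ≠ ∞) {M : ℕ}
    {X : Fin M → Ω → ℝ} (hX : ∀ j, Measurable (X j)) (hXi : ∀ j, Integrable (X j) P)
    (hind : iIndepFun X P) (hmean : ∀ j, ∫ ω, X j ω ∂P = 0) {N : ℝ≥0∞}
    (hN : ∀ j, eLpNorm (X j) q P = N) :
    eLpNorm (fun ω => ∑ j, X j ω) q P ≤
      ENNReal.ofReal (2 * khintchineConst q) * (M : ℝ≥0∞) ^ (1 / min q.toReal 2) * N := by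
  have hq0 : q ≠ 0 := (zero_lt_one.trans_le hq1).ne'
  have hQ : 0 < q.toReal := ENNReal.toReal_pos hq0 hq
  have hmin : 0 < min q.toReal 2 := lt_min hQ two_pos
  rw [← ENNReal.rpow_le_rpow_iff hQ, eLpNorm_rpow_toReal_eq_lintegral hq0 hq]
  refine (lintegral_sum_rpow_le_square_function hq1 hq hX hXi hind hmean).trans ?_
  rw [mul_assoc, ENNReal.mul_rpow_of_nonneg _ _ hQ.le]
  gcongr
  calc ∫⁻ ω, (∑ j, ‖X j ω‖ₑ ^ 2) ^ (q.toReal / 2) ∂P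
      ≤ ∫⁻ ω, (M : ℝ≥0∞) ^ (q.toReal / min q.toReal 2 - 1) *
          ∑ j, ‖X j ω‖ₑ ^ q.toReal ∂P := by
        refine lintegral_mono fun ω => ?_
        simpa using ENNReal.sum_sq_rpow_half_le Finset.univ (fun j => ‖X j ω‖ₑ) hQ
    _ = (M : ℝ≥0∞) ^ (q.toReal / min q.toReal 2 - 1) * (M * N ^ q.toReal) := by
        rw [lintegral_const_mul _ (by fun_prop), lintegral_finsetSum _ fun j _ => by fun_prop]
        simp_rw [← eLpNorm_rpow_toReal_eq_lintegral hq0 hq, hN]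
        simp
    _ = ((M : ℝ≥0∞) ^ (1 / min q.toReal 2) * N) ^ q.toReal := by
        rw [ENNReal.mul_rpow_of_nonneg _ _ hQ.le, ← mul_assoc, ← ENNReal.rpow_mul]
        congr 1
        -- Nonnegative exponents are needed to add powers, since `M` may be 0 here.
        have h1 : 1 ≤ q.toReal / min q.toReal 2 := by
          rw [one_le_div hmin]; exact min_le_left _ _
        nth_rewrite 2 [← ENNReal.rpow_one (M : ℝ≥0∞)]
        rw [← ENNReal.rpow_add_of_nonneg _ _ (by linarith) zero_le_one]
        congr 1
        ring

/-! ### Minkowski's inequality for mixed norms -/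

/-- **Minkowski's integral inequality** for the Lebesgue integral, when the left side is finite. -/
lemma lintegral_lintegral_rpow_le {S Ω : Type*} [MeasurableSpace S] [MeasurableSpace Ω]
    {μ : Measure S} [SFinite μ] {P : Measure Ω} [SFinite P] {g : S × Ω → ℝ≥0∞}
    (hg : Measurable g) {r : ℝ} (hr : 1 ≤ r)
    (hfin : ∫⁻ ω, (∫⁻ s, g (s, ω) ∂μ) ^ r ∂P ≠ ∞) :
    (∫⁻ ω, (∫⁻ s, g (s, ω) ∂μ) ^ r ∂P) ^ (1 / r) ≤
      ∫⁻ s, (∫⁻ ω, g (s, ω) ^ r ∂P) ^ (1 / r) ∂μ := by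
  rcases hr.eq_or_lt with rfl | hr1
  · simp only [ENNReal.rpow_one, div_one]
    exact (lintegral_lintegral_swap (f := fun ω s => g (s, ω))
      (hg.comp measurable_swap).aemeasurable).le
  have hr0 : 0 < r := by linarith
  set G : Ω → ℝ≥0∞ := fun ω => ∫⁻ s, g (s, ω) ∂μ with hG
  have hGm : Measurable G := hg.lintegral_prod_left'
  set I := ∫⁻ ω, G ω ^ r ∂P with hI
  rcases eq_or_ne I 0 with h0 | h0
  · rw [h0, ENNReal.zero_rpow_of_pos (by positivity)]
    exact zero_le
  have hconj : r.HolderConjugate (r / (r - 1)) := Real.HolderConjugate.conjExponent hr1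
  have hgs : ∀ s, Measurable fun ω => g (s, ω) := fun s => hg.comp measurable_prodMk_left
  -- Split `G ^ r = G * G ^ (r - 1)`, swap the integrals and apply Hölder in `ω`. The last factor is
  -- then cancelled, which requires `I` to be nonzero and finite.
  have hkey : I ≤ (∫⁻ s, (∫⁻ ω, g (s, ω) ^ r ∂P) ^ (1 / r) ∂μ) * I ^ (1 / (r / (r - 1))) := by
    calc I = ∫⁻ ω, ∫⁻ s, g (s, ω) * G ω ^ (r - 1) ∂μ ∂P := by
          refine lintegral_congr fun ω => ?_
          have hgω : Measurable fun s => g (s, ω) := hg.comp measurable_prodMk_right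
          rw [lintegral_mul_const _ hgω]
          change G ω ^ r = G ω * G ω ^ (r - 1)
          nth_rewrite 2 [← ENNReal.rpow_one (G ω)]
          rw [← ENNReal.rpow_add_of_nonneg _ _ zero_le_one (by linarith), add_sub_cancel]
      _ = ∫⁻ s, ∫⁻ ω, g (s, ω) * G ω ^ (r - 1) ∂P ∂μ :=
          lintegral_lintegral_swap (f := fun ω s => g (s, ω) * G ω ^ (r - 1))
            ((hg.comp measurable_swap).mul
              ((hGm.comp measurable_fst).pow_const _)).aemeasurable
      _ ≤ ∫⁻ s, (∫⁻ ω, g (s, ω) ^ r ∂P) ^ (1 / r) * I ^ (1 / (r / (r - 1))) ∂μ := by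
          refine lintegral_mono fun s => ?_
          refine (ENNReal.lintegral_mul_le_Lp_mul_Lq P hconj (hgs s).aemeasurable
            (hGm.pow_const (r - 1)).aemeasurable).trans_eq ?_
          congr 2
          refine lintegral_congr fun ω => ?_
          rw [← ENNReal.rpow_mul, mul_div_cancel₀ _ (by linarith)]
      _ = _ := lintegral_mul_const _ ((hg.pow_const r).lintegral_prod_right'.pow_const _)
  have hpow0 : I ^ (1 / (r / (r - 1))) ≠ 0 := by simp [ENNReal.rpow_eq_zero_iff, h0, hfin]
  have hpowt : I ^ (1 / (r / (r - 1))) ≠ ∞ :=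
    ENNReal.rpow_ne_top_of_nonneg hconj.symm.one_div_nonneg hfin
  refine (ENNReal.mul_le_mul_iff_left hpow0 hpowt).1 (le_of_eq_of_le ?_ hkey)
  rw [← ENNReal.rpow_add _ _ h0 hfin]
  have : 1 / r + 1 / (r / (r - 1)) = 1 := by field_simp; ring
  rw [this, ENNReal.rpow_one]

/-- Minkowski's inequality for mixed norms: for `p ≤ q` the norm of `L^q(Ω; L^p(S))` is dominated
by that of `L^p(S; L^q(Ω))`. -/
lemma eLpNorm_eLpNorm_le_of_exponent_le {S Ω : Type*} [MeasurableSpace S] [MeasurableSpace Ω]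
    {μ : Measure S} [SFinite μ] {P : Measure Ω} [SFinite P] {p q : ℝ≥0∞} (hp0 : p ≠ 0)
    (hpq : p ≤ q) (hq : q ≠ ∞) {f : S × Ω → ℝ} (hf : Measurable f)
    (hfin : eLpNorm (fun ω => eLpNorm (fun s => f (s, ω)) p μ) q P ≠ ∞) :
    eLpNorm (fun ω => eLpNorm (fun s => f (s, ω)) p μ) q P ≤
      eLpNorm (fun s => eLpNorm (fun ω => f (s, ω)) q P) p μ := by
  have hp : p ≠ ∞ := ne_top_of_le_ne_top hq hpq
  have hq0 : q ≠ 0 := (hp0.bot_lt.trans_le hpq).ne'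
  have hP : 0 < p.toReal := ENNReal.toReal_pos hp0 hp
  have hQ : 0 < q.toReal := ENNReal.toReal_pos hq0 hq
  -- Minkowski's integral inequality with exponent `q / p` is applied to `|f| ^ p`.
  set r := q.toReal / p.toReal with hr
  have hr1 : 1 ≤ r := (one_le_div hP).2 (ENNReal.toReal_mono hq hpq)
  have hLHS : eLpNorm (fun ω => eLpNorm (fun s => f (s, ω)) p μ) q P =
      (∫⁻ ω, (∫⁻ s, ‖f (s, ω)‖ₑ ^ p.toReal ∂μ) ^ r ∂P) ^ (1 / q.toReal) := by
    rw [eLpNorm_eq_lintegral_rpow_enorm_toReal hq0 hq]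
    congr 1
    refine lintegral_congr fun ω => ?_
    rw [enorm_eq_self, eLpNorm_eq_lintegral_rpow_enorm_toReal hp0 hp, ← ENNReal.rpow_mul, hr]
    congr 1
    ring
  have hRHS : eLpNorm (fun s => eLpNorm (fun ω => f (s, ω)) q P) p μ =
      (∫⁻ s, (∫⁻ ω, (‖f (s, ω)‖ₑ ^ p.toReal) ^ r ∂P) ^ (1 / r) ∂μ) ^ (1 / p.toReal) := by
    rw [eLpNorm_eq_lintegral_rpow_enorm_toReal hp0 hp]
    congr 1
    refine lintegral_congr fun s => ?_
    rw [enorm_eq_self, eLpNorm_eq_lintegral_rpow_enorm_toReal hq0 hq, ← ENNReal.rpow_mul]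
    congr 1
    · refine lintegral_congr fun ω => ?_
      rw [← ENNReal.rpow_mul, hr, mul_div_cancel₀ _ hP.ne']
    · rw [hr]; field_simp
  rw [hLHS] at hfin ⊢
  rw [hRHS]
  have hfin' : ∫⁻ ω, (∫⁻ s, ‖f (s, ω)‖ₑ ^ p.toReal ∂μ) ^ r ∂P ≠ ∞ := fun h => by
    rw [h, ENNReal.top_rpow_of_pos (by positivity)] at hfin
    exact hfin rfl
  have h := lintegral_lintegral_rpow_le (μ := μ) (P := P)
    (g := fun z => ‖f z‖ₑ ^ p.toReal) (by fun_prop) hr1 hfin'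
  have he : 1 / q.toReal = 1 / r * (1 / p.toReal) := by rw [hr]; field_simp
  rw [he, ENNReal.rpow_mul]
  gcongr

/-! ### Pointwise evaluation of `L^p`-valued variables -/

/-- A jointly measurable version of point evaluation on a separable subset of `L^p`. -/
lemma exists_measurable_evaluation {S : Type*} [MeasurableSpace S] {μ : Measure S} {p : ℝ≥0∞}
    [Fact (1 ≤ p)] [MeasurableSpace (Lp ℝ p μ)] [BorelSpace (Lp ℝ p μ)] {T : Set (Lp ℝ p μ)}
    (hT : TopologicalSpace.IsSeparable T) :
    ∃ e : S × Lp ℝ p μ → ℝ, Measurable e ∧ ∀ v ∈ T, (fun s => e (s, v)) =ᵐ[μ] v := by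
  classical
  obtain ⟨c₀, hc₀, hTc₀⟩ := hT
  obtain ⟨c, hc⟩ := (hc₀.insert 0).exists_eq_range (Set.insert_nonempty _ _)
  have hTc : T ⊆ closure (Set.range c) := by
    rw [← hc]
    exact hTc₀.trans (closure_mono (Set.subset_insert _ _))
  have hδ : ∀ n : ℕ, (0 : ℝ≥0∞) < 2⁻¹ ^ n := fun n => ENNReal.pow_pos (by simp) n
  -- The second alternative makes the search for a `2⁻¹ ^ n`-close point succeed for every `v`, so
  -- `φ n` is total and measurable.
  have hex : ∀ (n : ℕ) (v : Lp ℝ p μ), ∃ k, edist v (c k) < 2⁻¹ ^ n ∨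
      v ∉ closure (Set.range c) := fun n v => by
    by_cases hv : v ∈ closure (Set.range c)
    · obtain ⟨_, ⟨k, rfl⟩, hk⟩ := EMetric.mem_closure_iff.1 hv _ (hδ n)
      exact ⟨k, Or.inl hk⟩
    · exact ⟨0, Or.inr hv⟩
  set φ : ℕ → Lp ℝ p μ → ℕ := fun n v => Nat.find (hex n v) with hφ
  have hφm : ∀ n, Measurable (φ n) := fun n => measurable_find (hex n) fun k =>
    MeasurableSet.union (s₁ := {v | edist v (c k) < 2⁻¹ ^ n})
      (isOpen_lt (by fun_prop) continuous_const).measurableSet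
      (isClosed_closure (s := Set.range c)).measurableSet.compl
  have hcm : Measurable fun z : S × ℕ => c z.2 z.1 :=
    measurable_from_prod_countable_left fun k => (Lp.stronglyMeasurable (c k)).measurable
  refine ⟨fun z => limsup (fun n => c (φ n z.2) z.1) atTop, Measurable.limsup fun n =>
    hcm.comp (measurable_fst.prodMk ((hφm n).comp measurable_snd)), fun v hv => ?_⟩
  set u : ℕ → Lp ℝ p μ := fun n => c (φ n v) with hu
  have huv : ∀ n, edist v (u n) < 2⁻¹ ^ n := fun n =>
    (Nat.find_spec (hex n v)).resolve_right (not_not.2 (hTc hv))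
  have hmono : ∀ {m n : ℕ}, m ≤ n → (2⁻¹ : ℝ≥0∞) ^ n ≤ 2⁻¹ ^ m := fun h =>
    pow_le_pow_right_of_le_one' (by simp) h
  -- Geometric closeness gives almost everywhere convergence of the whole sequence; a subsequence
  -- then suffices to identify the limit as `v`.
  have hlim : ∀ᵐ s ∂μ, ∃ l, Tendsto (fun n => u n s) atTop (𝓝 l) := by
    refine Lp.ae_tendsto_of_cauchy_eLpNorm (f := fun n => u n)
      (fun n => Lp.aestronglyMeasurable (u n)) (Fact.out : 1 ≤ p) (B := fun n => 2 * 2⁻¹ ^ n)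
      ?_ ?_
    · rw [ENNReal.tsum_mul_left, ENNReal.tsum_geometric]
      simp [ENNReal.mul_eq_top]
    · intro N n m hn hm
      rw [← Lp.edist_def, two_mul]
      refine (edist_triangle_left (u n) (u m) v).trans_lt ?_
      exact ENNReal.add_lt_add ((huv n).trans_le (hmono hn)) ((huv m).trans_le (hmono hm))
  have hp0 : p ≠ 0 := (zero_lt_one.trans_le (Fact.out : 1 ≤ p)).ne'
  have htend : Tendsto (fun n => eLpNorm ((u n : S → ℝ) - (v : S → ℝ)) p μ) atTop (𝓝 0) := by
    refine tendsto_of_tendsto_of_tendsto_of_le_of_le tendsto_const_nhds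
      (ENNReal.tendsto_pow_atTop_nhds_zero_of_lt_one (r := 2⁻¹) (by simp)) (fun _ => zero_le)
      fun n => ?_
    change eLpNorm ((u n : S → ℝ) - (v : S → ℝ)) p μ ≤ _
    rw [← Lp.edist_def, edist_comm]
    exact (huv n).le
  obtain ⟨ns, hns, hsub⟩ := (tendstoInMeasure_of_tendsto_eLpNorm hp0
    (fun n => Lp.aestronglyMeasurable (u n)) (Lp.aestronglyMeasurable v)
    htend).exists_seq_tendsto_ae
  filter_upwards [hlim, hsub] with s ⟨l, hl⟩ hs
  have : l = v s := tendsto_nhds_unique (hl.comp hns.tendsto_atTop) hs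
  rw [← this]
  exact hl.limsup_eq

/-- Hölder's inequality on `A`; it makes integration over a set of finite measure continuous on
`L^p`. -/
lemma MeasureTheory.Lp.eLpNorm_one_restrict_le {S : Type*} [MeasurableSpace S] {μ : Measure S} {p : ℝ≥0∞}
    [hp : Fact (1 ≤ p)] (A : Set S) (v : Lp ℝ p μ) :
    eLpNorm v 1 (μ.restrict A) ≤ μ A ^ (1 - 1 / p.toReal) * ‖v‖ₑ := by
  have h := eLpNorm_le_eLpNorm_mul_rpow_measure_univ (μ := μ.restrict A) (f := (v : S → ℝ)) hp.out
    (Lp.aestronglyMeasurable v).restrict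
  rw [Measure.restrict_apply_univ, ENNReal.toReal_one, div_one, mul_comm] at h
  refine h.trans ?_
  rw [Lp.enorm_def]
  gcongr
  exact Measure.restrict_le_self

lemma measure_rpow_one_sub_ne_top {S : Type*} [MeasurableSpace S] {μ : Measure S} {p : ℝ≥0∞}
    (hp : 1 ≤ p) {A : Set S} (hA : μ A ≠ ∞) : μ A ^ (1 - 1 / p.toReal) ≠ ∞ := by
  refine ENNReal.rpow_ne_top_of_nonneg ?_ hA
  rcases eq_or_ne p ∞ with rfl | hp'
  · simp
  · have : 1 ≤ p.toReal := by simpa using ENNReal.toReal_mono hp' hp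
    rw [sub_nonneg, div_le_one (by linarith)]
    exact this

/-- Integration over a set of finite measure, as a functional on `L^p`. -/
noncomputable def setIntegralLp {S : Type*} [MeasurableSpace S] (μ : Measure S) (p : ℝ≥0∞)
    [hp : Fact (1 ≤ p)] {A : Set S} (hA : μ A ≠ ∞) : Lp ℝ p μ →L[ℝ] ℝ :=
  have hint (v : Lp ℝ p μ) : Integrable v (μ.restrict A) :=
    memLp_one_iff_integrable.1 ⟨(Lp.aestronglyMeasurable v).restrict,
      (Lp.eLpNorm_one_restrict_le A v).trans_lt
        (ENNReal.mul_lt_top (measure_rpow_one_sub_ne_top hp.out hA).lt_top enorm_lt_top)⟩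
  LinearMap.mkContinuous
    { toFun := fun v => ∫ s in A, v s ∂μ
      map_add' := fun v w => by
        rw [← integral_add (hint v) (hint w)]
        exact integral_congr_ae (ae_restrict_of_ae (Lp.coeFn_add v w))
      map_smul' := fun a v => by
        rw [RingHom.id_apply, ← integral_smul]
        exact integral_congr_ae (ae_restrict_of_ae (Lp.coeFn_smul a v)) }
    (μ A ^ (1 - 1 / p.toReal)).toReal
    (fun v => by
      have hfin := measure_rpow_one_sub_ne_top hp.out hA
      have h := (enorm_integral_le_lintegral_enorm (μ := μ.restrict A) (v : S → ℝ)).trans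
        ((eLpNorm_one_eq_lintegral_enorm (μ := μ.restrict A)).ge.trans
          (Lp.eLpNorm_one_restrict_le A v))
      have h2 := ENNReal.toReal_mono (ENNReal.mul_ne_top hfin enorm_ne_top) h
      rwa [ENNReal.toReal_mul, toReal_enorm, toReal_enorm] at h2)

lemma setIntegralLp_apply {S : Type*} [MeasurableSpace S] {μ : Measure S} {p : ℝ≥0∞}
    [Fact (1 ≤ p)] {A : Set S} (hA : μ A ≠ ∞) (v : Lp ℝ p μ) :
    setIntegralLp μ p hA v = ∫ s in A, v s ∂μ := rfl

/-- If the Bochner expectation of an `L^p`-valued random variable vanishes, then so do almost all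
of its pointwise expectations. -/
lemma ae_integral_eq_zero_of_integral_Lp_eq_zero {S Ω : Type*} [MeasurableSpace S]
    [MeasurableSpace Ω] {μ : Measure S} [SigmaFinite μ] {P : Measure Ω} [SFinite P]
    {p : ℝ≥0∞} [hp : Fact (1 ≤ p)] {η : Ω → Lp ℝ p μ} (hη : Integrable η P) {f : S × Ω → ℝ}
    (hf : Measurable f) (hfη : ∀ᵐ ω ∂P, (η ω : S → ℝ) =ᵐ[μ] fun s => f (s, ω))
    (hmean : ∫ ω, η ω ∂P = 0) : ∀ᵐ s ∂μ, ∫ ω, f (s, ω) ∂P = 0 := by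
  have hint : ∀ A : Set S, MeasurableSet A → μ A < ∞ →
      Integrable f ((μ.restrict A).prod P) := fun A _ hA => by
    refine ⟨hf.aestronglyMeasurable, ?_⟩
    rw [HasFiniteIntegral, lintegral_prod_symm' _ (by fun_prop)]
    calc ∫⁻ ω, ∫⁻ s in A, ‖f (s, ω)‖ₑ ∂μ ∂P
        ≤ ∫⁻ ω, μ A ^ (1 - 1 / p.toReal) * ‖η ω‖ₑ ∂P := by
          refine lintegral_mono_ae ?_
          filter_upwards [hfη] with ω hω
          rw [← eLpNorm_one_eq_lintegral_enorm,
            ← eLpNorm_congr_ae (ae_restrict_of_ae hω)]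
          exact Lp.eLpNorm_one_restrict_le A (η ω)
      _ = μ A ^ (1 - 1 / p.toReal) * ∫⁻ ω, ‖η ω‖ₑ ∂P :=
          lintegral_const_mul'' _ hη.aestronglyMeasurable.enorm
      _ < ∞ := ENNReal.mul_lt_top (measure_rpow_one_sub_ne_top hp.out hA.ne).lt_top hη.2
  -- It suffices to test on sets of finite measure, where Fubini applies and the integral is a
  -- continuous functional, which commutes with the Bochner expectation.
  refine ae_eq_zero_of_forall_setIntegral_eq_of_sigmaFinite
    (fun A hA hA' => (hint A hA hA').integral_prod_left) fun A hA hA' => ?_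
  calc ∫ s in A, ∫ ω, f (s, ω) ∂P ∂μ = ∫ ω, ∫ s in A, f (s, ω) ∂μ ∂P :=
        integral_integral_swap (f := fun s ω => f (s, ω)) (hint A hA hA')
    _ = ∫ ω, setIntegralLp μ p hA'.ne (η ω) ∂P := by
        refine integral_congr_ae ?_
        filter_upwards [hfη] with ω hω
        rw [setIntegralLp_apply]
        exact (integral_congr_ae (ae_restrict_of_ae hω)).symm
    _ = 0 := by rw [ContinuousLinearMap.integral_comp_comm _ hη, hmean, map_zero]

/-- A jointly measurable representative of an `L^p`-valued random variable is, at almost every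
point, a fixed measurable function of that random variable. -/
lemma ae_ae_eq_evaluation {S Ω : Type*} [MeasurableSpace S] [MeasurableSpace Ω] {μ : Measure S}
    [SFinite μ] {P : Measure Ω} [SFinite P] {p : ℝ≥0∞} [Fact (1 ≤ p)]
    [MeasurableSpace (Lp ℝ p μ)] [BorelSpace (Lp ℝ p μ)] {η : Ω → Lp ℝ p μ}
    (hη : AEStronglyMeasurable η P) {f : S × Ω → ℝ} (hf : Measurable f)
    (hfη : ∀ᵐ ω ∂P, (η ω : S → ℝ) =ᵐ[μ] fun s => f (s, ω)) {T : Set (Lp ℝ p μ)}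
    (hT : ∀ᵐ ω ∂P, η ω ∈ T) {e : S × Lp ℝ p μ → ℝ} (he : Measurable e)
    (heT : ∀ v ∈ T, (fun s => e (s, v)) =ᵐ[μ] v) :
    ∀ᵐ s ∂μ, (fun ω => e (s, η ω)) =ᵐ[P] fun ω => f (s, ω) := by
  -- A strongly measurable version of `η` makes the equality set measurable, so the almost
  -- everywhere quantifiers can be exchanged.
  have hm : MeasurableSet {z : S × Ω | e (z.1, hη.mk η z.2) = f (z.1, z.2)} :=
    measurableSet_eq_fun (he.comp (measurable_fst.prodMk
      (hη.stronglyMeasurable_mk.measurable.comp measurable_snd))) hf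
  have h : ∀ᵐ ω ∂P, ∀ᵐ s ∂μ, e (s, hη.mk η ω) = f (s, ω) := by
    filter_upwards [hfη, hT, hη.ae_eq_mk] with ω h1 h2 h3
    rw [← h3]
    exact (heT _ h2).trans h1
  filter_upwards [(Measure.ae_ae_comm hm).2 h] with s hs
  filter_upwards [hs, hη.ae_eq_mk] with ω h1 h2
  rw [h2, h1]

/-! ### The pointwise estimate and its integration -/

/-- Pointwise estimate: for almost every `s`, the sum of the representatives at `s` is bounded in
`L^q(Ω)` by the norm of one of them. -/
lemma ae_eLpNorm_sum_le {S : Type*} [MeasurableSpace S] {μ : Measure S} [SigmaFinite μ]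
    {Ω : Type*} [MeasurableSpace Ω] {P : Measure Ω} [IsProbabilityMeasure P]
    {p q : ℝ≥0∞} [Fact (1 ≤ p)] [hq1 : Fact (1 ≤ q)] (hq : q ≠ ∞)
    [MeasurableSpace (Lp ℝ p μ)] [BorelSpace (Lp ℝ p μ)] {M : ℕ} [NeZero M]
    {η : Fin M → Ω → Lp ℝ p μ} {F : Fin M → S → Lp ℝ q P} {f : Fin M → S × Ω → ℝ}
    (hη : ∀ j, MemLp (η j) q P) (hf : ∀ j, Measurable (f j))
    (hfη : ∀ j, ∀ᵐ ω ∂P, (η j ω : S → ℝ) =ᵐ[μ] fun s => f j (s, ω))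
    (hfF : ∀ j, ∀ᵐ s ∂μ, (F j s : Ω → ℝ) =ᵐ[P] fun ω => f j (s, ω))
    (hindep : iIndepFun η P) (hident : ∀ i j, IdentDistrib (η i) (η j) P P)
    (hmean : ∫ ω, η 0 ω ∂P = 0) :
    ∀ᵐ s ∂μ, eLpNorm (fun ω => ∑ j, f j (s, ω)) q P ≤
      ENNReal.ofReal (2 * khintchineConst q) * (M : ℝ≥0∞) ^ (1 / min q.toReal 2) * ‖F 0 s‖ₑ := by
  choose T hT hηT using fun j => (hη j).aestronglyMeasurable.isSeparable_ae_range
  -- A single `e` for all `j` is essential: equality in law passes to the values only through a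
  -- common map.
  obtain ⟨e, he, heT⟩ := exists_measurable_evaluation (.iUnion hT)
  have heval : ∀ᵐ s ∂μ, ∀ j, (fun ω => e (s, η j ω)) =ᵐ[P] fun ω => f j (s, ω) :=
    ae_all_iff.2 fun j => ae_ae_eq_evaluation (hη j).aestronglyMeasurable (hf j) (hfη j)
      ((hηT j).mono fun ω h => Set.mem_iUnion_of_mem j h) he heT
  have hzero : ∀ᵐ s ∂μ, ∀ j, ∫ ω, f j (s, ω) ∂P = 0 := ae_all_iff.2 fun j =>
    ae_integral_eq_zero_of_integral_Lp_eq_zero ((hη j).integrable hq1.out) (hf j) (hfη j)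
      ((hident j 0).integral_eq.trans hmean)
  filter_upwards [heval, hzero, ae_all_iff.2 hfF] with s hs1 hs2 hs3
  have hfm : ∀ j, Measurable fun ω => f j (s, ω) := fun j => (hf j).comp measurable_prodMk_left
  have hes : Measurable fun v => e (s, v) := he.comp measurable_prodMk_left
  have hLq : ∀ j, MemLp (fun ω => f j (s, ω)) q P := fun j =>
    (Lp.memLp (F j s)).ae_eq (hs3 j)
  refine eLpNorm_sum_le_of_iIndepFun hq1.out hq hfm (fun j => (hLq j).integrable hq1.out)
    ((hindep.comp (fun _ v => e (s, v)) fun _ => hes).congr hs1) hs2 fun j => ?_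
  rw [Lp.enorm_def, eLpNorm_congr_ae (hs3 0), ← eLpNorm_congr_ae (hs1 j),
    ← eLpNorm_congr_ae (hs1 0)]
  exact ((hident j 0).comp hes).eLpNorm_eq q

lemma enorm_inv_natCast_mul_rpow {M : ℕ} (hM : M ≠ 0) {K : ℝ} (hK : 0 ≤ K) (t : ℝ) :
    ‖(M : ℝ)⁻¹‖ₑ * (ENNReal.ofReal K * (M : ℝ≥0∞) ^ t) =
      ENNReal.ofReal (K * (M : ℝ) ^ (-(1 - t))) := by
  have hM0 : (0 : ℝ) < M := by positivity
  rw [← ofReal_norm, Real.norm_of_nonneg (by positivity), ← ENNReal.ofReal_natCast,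
    ENNReal.ofReal_rpow_of_pos hM0, ← ENNReal.ofReal_mul hK, ← ENNReal.ofReal_mul (by positivity)]
  congr 1
  rw [neg_sub, Real.rpow_sub hM0, Real.rpow_one]
  field_simp

/- The measurable evaluation map on a separable subset of `L^p(S)` transfers independence and
equality in law from the `η j` to their values at almost every point, so neither the approximation
property of `μ` nor the finiteness of the norms of the `F j` enters the proof. -/
theorem mainTheorem1 {S : Type u} [MeasurableSpace S] (μ : Measure S) [SigmaFinite μ]
    (hμ : ApproximationByAveraging.{u, v} μ)
    {Ω : Type v} [MeasurableSpace Ω] (P : Measure Ω) [IsProbabilityMeasure P]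
    (p q : ℝ≥0∞) [Fact (1 ≤ p)] [Fact (1 ≤ q)] (hpq : p ≤ q) (hq : q ≠ ∞)
    [MeasurableSpace (Lp ℝ p μ)] [BorelSpace (Lp ℝ p μ)]
    (M : ℕ) [NeZero M]
    (η : Fin M → Ω → Lp ℝ p μ) (F : Fin M → S → Lp ℝ q P)
    (hη : ∀ j, MemLp (η j) q P) (hF : ∀ j, MemLp (F j) p μ)
    (hηF : ∀ j, HaveCommonRepresentative (η j) (F j))
    (hindep : iIndepFun η P) (hident : ∀ i j, IdentDistrib (η i) (η j) P P)
    (hmean : ∫ ω, η 0 ω ∂P = 0) :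
    eLpNorm (fun ω => (M : ℝ)⁻¹ • ∑ j, η j ω) q P ≤
      ENNReal.ofReal (2 * khintchineConst q * (M : ℝ) ^ (-(1 - 1 / (min q 2).toReal))) *
        eLpNorm (F 0) p μ := by
  choose f hf hfη hfF using hηF
  have hp0 : p ≠ 0 := (zero_lt_one.trans_le (Fact.out : 1 ≤ p)).ne'
  have hsum : MemLp (fun ω => ∑ j, η j ω) q P := memLp_finsetSum _ fun j _ => hη j
  have hnorm : eLpNorm (fun ω => ∑ j, η j ω) q P =
      eLpNorm (fun ω => eLpNorm (fun s => ∑ j, f j (s, ω)) p μ) q P := by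
    refine eLpNorm_congr_enorm_ae ?_
    filter_upwards [ae_all_iff.2 hfη] with ω hω
    rw [enorm_eq_self, Lp.enorm_def]
    refine eLpNorm_congr_ae ((Lp.coeFn_finsetSum _ _).trans ?_)
    filter_upwards [ae_all_iff.2 hω] with s hs
    simp [hs]
  set C : ℝ≥0∞ := ENNReal.ofReal (2 * khintchineConst q) *
    (M : ℝ≥0∞) ^ (1 / min q.toReal 2) with hC
  have hCtop : C ≠ ∞ := ENNReal.mul_ne_top ENNReal.ofReal_ne_top
    (ENNReal.rpow_ne_top_of_nonneg (by positivity) (ENNReal.natCast_ne_top M))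
  have hbound : eLpNorm (fun ω => ∑ j, η j ω) q P ≤ C * eLpNorm (F 0) p μ := by
    have hfin := hsum.eLpNorm_ne_top
    rw [hnorm] at hfin ⊢
    refine (eLpNorm_eLpNorm_le_of_exponent_le (f := fun z => ∑ j, f j z) hp0 hpq hq
      (Finset.measurable_sum _ fun j _ => hf j) hfin).trans ?_
    have h := eLpNorm_le_nnreal_smul_eLpNorm_of_ae_le_mul' (c := C.toNNReal)
      (f := fun s => eLpNorm (fun ω => ∑ j, f j (s, ω)) q P) (g := F 0) (μ := μ) (by
        filter_upwards [ae_eLpNorm_sum_le hq hη hf hfη hfF hindep hident hmean] with s hs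
        rwa [enorm_eq_self, ENNReal.coe_toNNReal hCtop]) p
    rwa [ENNReal.smul_def, smul_eq_mul, ENNReal.coe_toNNReal hCtop] at h
  -- The factor `M⁻¹` of the mean turns `M ^ (1 / min q 2)` into the claimed rate.
  have hconst := enorm_inv_natCast_mul_rpow (NeZero.ne M)
    (mul_nonneg zero_le_two (khintchineConst_nonneg q)) (1 / min q.toReal 2)
  rw [ENNReal.toReal_min hq ENNReal.ofNat_ne_top, ENNReal.toReal_ofNat, ← hconst, mul_assoc]
  refine (eLpNorm_const_smul (M : ℝ)⁻¹ (fun ω => ∑ j, η j ω) q P).le.trans ?_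
  gcongr
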